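/- A triple system (3-uniform hypergraph) on a vertex set $V$ is a collection of 3-element subsets of $V$, called edges. Let $K_t^3$ be the complete triple system on $t$ vertices, let $K_5^{3-}$ be the triple system on five vertices obtained from $K_5^3$ by deleting one edge, and let $C_5^3$ be the tight cycle with vertex set $\mathbb{Z}/5$ and edges $\{i,i+1,i+2\}$, $i\in\mathbb{Z}/5$. For triple systems $F,G$, let $r(F,G)$ be the minimum $n$ such that every red/blue coloring of the edges of $K_n^3$ contains a red copy of $F$ or a blue copy of $G$. Then $$r(K_5^{3-},K_t^3)=2^{O(t^2\log t)},$$ that is, there is a constant $C>0$ such that for every integer $t\ge 2$ the number $r(K_5^{3-},K_t^3)$ exists and satisfies $$r(K_5^{3-},K_t^3)\le 2^{C t^2\log t}.$$ Moreover, $C_5^3\subset K_5^{3-}$ (that is, $K_5^{3-}$ contains a copy of $C_5^3$), and there is a constant $b>0$ such that for every integer $t\ge 2$ the number $r(C_5^3,K_t^3)$ exists and satisfies $$r(C_5^3,K_t^3)<2^{b t^2\log t}.$$ -/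

import Mathlib

/-- A `k`-uniform hypergraph on the vertex set `V`: a collection of `k`-element subsets of `V`. -/
structure UniformHypergraph (k : ℕ) (V : Type) where
  edges : Set (Finset V)
  uniform : ∀ e ∈ edges, e.card = k

namespace UniformHypergraph

/-- The complete `k`-uniform hypergraph `K_n^k` on the `n` vertices of `Fin n`. -/
def complete (k n : ℕ) : UniformHypergraph k (Fin n) where
  edges := {e | e.card = k}
  uniform := fun _ he => he

/-- The hypergraph obtained by deleting the single edge `e₀` (no vertex is deleted). -/
def deleteEdge {k : ℕ} {V : Type} (H : UniformHypergraph k V) (e₀ : Finset V) :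
    UniformHypergraph k V where
  edges := H.edges \ {e₀}
  uniform := fun e he => H.uniform e he.1

/-- `K_5^{3-}`: the complete triple system on five vertices with one edge deleted. -/
def K5minus : UniformHypergraph 3 (Fin 5) :=
  (complete 3 5).deleteEdge {2, 3, 4}

/-- The tight cycle `C_s^k` (for `s ≥ k`): the vertex set is `ℤ/s` and the edges are the sets
`{i, i+1, …, i+k-1}`. For `s ≥ k` the cardinality condition holds automatically. -/
def tightCycle (k s : ℕ) : UniformHypergraph k (ZMod s) where
  edges := {e | e.card = k ∧
    ∃ i : ZMod s, e = (Finset.range k).image (fun j : ℕ => i + (j : ZMod s))}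
  uniform := fun _ he => he.1

/-- `F ⊂ G`: there is a copy of `F` inside `G`. -/
def IsContainedIn {k : ℕ} {V W : Type} (F : UniformHypergraph k V)
    (G : UniformHypergraph k W) : Prop :=
  ∃ f : V ↪ W, ∀ e ∈ F.edges, e.map f ∈ G.edges

/-- The two colors. -/
inductive EdgeColor : Type
  | red
  | blue

/-- A red/blue coloring of (the edges of) `K_n^k`. -/
abbrev Coloring (k n : ℕ) : Type := {e : Finset (Fin n) // e.card = k} → EdgeColor

/-- The coloring `c` of `K_n^k` has a monochromatic copy of `F` in color `x`. -/
def HasMonoCopy {k n : ℕ} {V : Type} (c : Coloring k n) (x : EdgeColor)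
    (F : UniformHypergraph k V) : Prop :=
  ∃ f : V ↪ Fin n, ∀ (e : Finset V) (he : e ∈ F.edges),
    c ⟨e.map f, (Finset.card_map f).trans (F.uniform e he)⟩ = x

/-- Every red/blue coloring of `K_n^k` has a red copy of `F` or a blue copy of `G`. -/
def Arrows {k : ℕ} {V W : Type} (n : ℕ) (F : UniformHypergraph k V)
    (G : UniformHypergraph k W) : Prop :=
  ∀ c : Coloring k n, HasMonoCopy c EdgeColor.red F ∨ HasMonoCopy c EdgeColor.blue G

/-- The Ramsey number `r(F, G)`: the minimum `n` such that every red/blue coloring of `K_n^k` has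
a red copy of `F` or a blue copy of `G`. -/
noncomputable def ramseyNumber {k : ℕ} {V W : Type} (F : UniformHypergraph k V)
    (G : UniformHypergraph k W) : ℕ :=
  sInf {n : ℕ | Arrows n F G}

end UniformHypergraph

/-!
Insert the vertices one at a time into a binary search tree: a new vertex `v` passing a node `w`
goes to the child of color `k`, and we keep only those unprocessed vertices `x` for which
`{x, v, w}` has color `k`. On every branch the color of a triple is then the direction taken at its
earliest vertex. If there is no blue `K_t^3`, a branch makes fewer than `t` blue steps; if there is
no red `K_{s+3}^{3-}`, it makes at most `s` red ones, with at most one node after the last of them,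
because `s` red steps followed by any three vertices give all triples but the one formed by these
three. Hence the tree has `O(t^s)` nodes.

At every node the color `k` can be chosen so that its share of the unprocessed vertices is at least
`1 / (2t)` if `k` is red and `1 - 1 / (2t)` if `k` is blue. An insertion thus keeps a fraction
`(1 / (2t))^s * (1 - 1 / (2t))^t ≥ 1 / (2 (2t)^s)` of them, so `t^{O(t^s)}` vertices are enough to
outgrow the tree. The theorem is the case `s = 2`.
-/

namespace UniformHypergraph

section ColoredPaths

variable {V κ : Type*} [DecidableEq V] {col : Finset V → κ}

/-- A branch of a search tree, from its last vertex up to the root. Every vertex carries a color,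
and the color of a triple is the one carried by its earliest vertex, the last in the list. -/
def IsColoredPath (col : Finset V → κ) : List (V × κ) → Prop
  | [] => True
  | x :: l => x.1 ∉ l.map Prod.fst ∧ l.Pairwise (fun q r => col {x.1, q.1, r.1} = r.2) ∧
      IsColoredPath col l

/-- The path `l` can be continued by `v` and then `x`. The colors carried by these two do not
matter, as neither is the earliest vertex of a triple. -/
def AdmitsPair (col : Finset V → κ) (l : List (V × κ)) (v x : V) : Prop :=
  ∀ i j : κ, IsColoredPath col ((x, i) :: (v, j) :: l)

theorem IsColoredPath.sublist {l m : List (V × κ)} (h : IsColoredPath col l) (hm : m.Sublist l) :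
    IsColoredPath col m := by
  induction hm with
  | slnil => trivial
  | cons a _ ih => exact ih h.2.2
  | cons_cons a hm ih =>
    exact ⟨fun ha => h.1 ((hm.map _).subset ha), h.2.1.sublist hm, ih h.2.2⟩

theorem IsColoredPath.nodup {l : List (V × κ)} (h : IsColoredPath col l) :
    (l.map Prod.fst).Nodup := by
  induction l with
  | nil => exact List.nodup_nil
  | cons x l ih => exact List.nodup_cons.2 ⟨h.1, ih h.2.2⟩

theorem IsColoredPath.exists_triple_sublist {l : List (V × κ)} (h : IsColoredPath col l)
    {e : Finset V} (he : e.card = 3) (hel : e ⊆ (l.map Prod.fst).toFinset) :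
    ∃ p q r, [p, q, r].Sublist l ∧ e = {p.1, q.1, r.1} ∧ col e = r.2 := by
  set m := l.filter (fun a => a.1 ∈ e)
  have hm : IsColoredPath col m := h.sublist List.filter_sublist
  have hem : (m.map Prod.fst).toFinset = e := by
    ext v
    have : v ∈ e → ∃ k, (v, k) ∈ l := fun hv => by simpa using hel hv
    simp only [m, List.mem_toFinset, List.mem_map, List.mem_filter, decide_eq_true_eq]
    aesop
  have hlen : m.length = 3 := by
    rw [← he, ← hem, List.toFinset_card_of_nodup hm.nodup, List.length_map]
  obtain ⟨p, q, r, hpqr⟩ := List.length_eq_three.1 hlen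
  have hsub : [p, q, r].Sublist l := hpqr ▸ List.filter_sublist
  have he' : e = {p.1, q.1, r.1} := by simpa [hpqr] using hem.symm
  exact ⟨p, q, r, hsub, he', by simpa [he', IsColoredPath] using (h.sublist hsub).2.1⟩

theorem AdmitsPair.cons {l : List (V × κ)} {v w x : V} {k : κ} (hvx : AdmitsPair col l v x)
    (hwx : AdmitsPair col l w x) (hwv : AdmitsPair col l w v) (hk : col {x, v, w} = k) :
    AdmitsPair col ((w, k) :: l) v x := by
  intro i j
  have h₁ := hvx i j
  have h₂ := hwx i j
  have h₃ := hwv i j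
  simp only [IsColoredPath, List.map_cons, List.mem_cons, List.pairwise_cons] at h₁ h₂ h₃ ⊢
  grind

end ColoredPaths

section Pigeonhole

variable {α κ : Type*} [Fintype κ] [DecidableEq κ]

theorem exists_mul_card_le_card_filter {p : κ → ℝ} (hp : ∑ k, p k = 1) (A : Finset α)
    (f : α → κ) : ∃ k, p k * A.card ≤ (A.filter (f · = k)).card := by
  have hsum : ∑ k, p k * A.card = ∑ k, ((A.filter (f · = k)).card : ℝ) := by
    rw [← Finset.sum_mul, hp, one_mul]
    exact_mod_cast Finset.card_eq_sum_card_fiberwise (t := Finset.univ) (by simp)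
  have hne : (Finset.univ : Finset κ).Nonempty :=
    Finset.nonempty_of_sum_ne_zero (f := p) (by rw [hp]; exact one_ne_zero)
  obtain ⟨k, -, hk⟩ := Finset.exists_le_of_sum_le hne hsum.le
  exact ⟨k, hk⟩

end Pigeonhole

/-- Search trees with nodes labelled by vertices and one child for each color. -/
inductive SearchTree (V κ : Type*)
  | leaf : SearchTree V κ
  | node (w : V) (child : κ → SearchTree V κ) : SearchTree V κ

namespace SearchTree

variable {V κ : Type*}

/-- The number of nodes, leaves not counted. -/
def size [Fintype κ] : SearchTree V κ → ℕ
  | leaf => 0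
  | node _ child => 1 + ∑ k, (child k).size

/-- The tree hangs at the end of the path `l`, and every branch of it can be continued by every
vertex of `S`. -/
def IsCompatible [DecidableEq V] (col : Finset V → κ) (S : Finset V) :
    List (V × κ) → SearchTree V κ → Prop
  | _, leaf => True
  | l, node w child => (∀ x ∈ S, AdmitsPair col l w x) ∧
      ∀ k, IsCompatible col S ((w, k) :: l) (child k)

theorem size_node_update [Fintype κ] [DecidableEq κ] (w : V) (child : κ → SearchTree V κ) (k : κ)
    (T : SearchTree V κ) :
    (node w (Function.update child k T)).size + (child k).size =
      (node w child).size + T.size := by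
  simp only [size, Function.apply_update (fun _ => size),
    Finset.sum_update_of_mem (Finset.mem_univ k)]
  rw [← Finset.add_sum_erase _ _ (Finset.mem_univ k), Finset.sdiff_singleton_eq_erase]
  ring

variable [DecidableEq V] {col : Finset V → κ}

theorem IsCompatible.mono {S S' : Finset V} (hS : S' ⊆ S) {l : List (V × κ)}
    {T : SearchTree V κ} (h : T.IsCompatible col S l) : T.IsCompatible col S' l := by
  induction T generalizing l with
  | leaf => trivial
  | node w child ih => exact ⟨fun x hx => h.1 x (hS hx), fun k => ih k (h.2 k)⟩

theorem IsCompatible.node_update [DecidableEq κ] {S A : Finset V} {l : List (V × κ)} {w : V}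
    {child : κ → SearchTree V κ} (h : (node w child).IsCompatible col S l) (hA : A ⊆ S) {k : κ}
    {T : SearchTree V κ} (hT : T.IsCompatible col A ((w, k) :: l)) :
    (node w (Function.update child k T)).IsCompatible col A l := by
  refine ⟨(h.mono hA).1, fun k' => ?_⟩
  obtain rfl | hk := eq_or_ne k' k
  · rwa [Function.update_self]
  · rw [Function.update_of_ne hk]
    exact (h.mono hA).2 k'

theorem IsCompatible.exists_insert [Fintype κ] {p : κ → ℝ} (hp : ∀ k, 0 ≤ p k)
    (hsum : ∑ k, p k = 1) {S A : Finset V} {v : V} (hv : v ∈ S) (hAS : A ⊆ S)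
    {l : List (V × κ)} (hA : ∀ x ∈ A, AdmitsPair col l v x) {T : SearchTree V κ}
    (hT : T.IsCompatible col S l) :
    ∃ (T' : SearchTree V κ) (m : List (V × κ)), ∃ A' ⊆ A, T'.IsCompatible col A' l ∧
      T'.size = T.size + 1 ∧ (∀ x ∈ A', AdmitsPair col (m ++ l) v x) ∧
      A.card * ((m.map Prod.snd).map p).prod ≤ A'.card := by
  classical
  induction T generalizing l A with
  | leaf =>
    exact ⟨node v fun _ => leaf, [], A, subset_rfl, ⟨hA, fun _ => trivial⟩, by simp [size], hA,
      by simp⟩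
  | node w child ih =>
    obtain ⟨k, hk⟩ := exists_mul_card_le_card_filter hsum A fun x => col {x, v, w}
    set B := A.filter fun x => col {x, v, w} = k
    have hBA : B ⊆ A := Finset.filter_subset _ _
    have hB : ∀ x ∈ B, AdmitsPair col ((w, k) :: l) v x := fun x hx =>
      (hA x (hBA hx)).cons (hT.1 x (hAS (hBA hx))) (hT.1 v hv) (Finset.mem_filter.1 hx).2
    obtain ⟨T', m, A', hA'B, hT', hsize, hpair, hcard⟩ := ih k (hBA.trans hAS) hB (hT.2 k)
    refine ⟨node w (Function.update child k T'), m ++ [(w, k)], A', hA'B.trans hBA,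
      hT.node_update ((hA'B.trans hBA).trans hAS) hT', ?_, by simpa using hpair, ?_⟩
    · have := size_node_update w child k T'
      omega
    · have hprod : 0 ≤ ((m.map Prod.snd).map p).prod :=
        List.prod_nonneg (by simp only [List.mem_map]; grind)
      calc A.card * (((m ++ [(w, k)]).map Prod.snd).map p).prod
          = p k * A.card * ((m.map Prod.snd).map p).prod := by
            simp only [List.map_append, List.prod_append, List.map_cons, List.map_nil,
              List.prod_singleton]
            ring
        _ ≤ B.card * ((m.map Prod.snd).map p).prod := by gcongr
        _ ≤ A'.card := hcard

end SearchTree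

namespace EdgeColor

instance : DecidableEq EdgeColor
  | red, red => isTrue rfl
  | red, blue => isFalse nofun
  | blue, red => isFalse nofun
  | blue, blue => isTrue rfl

instance : Fintype EdgeColor := ⟨{red, blue}, fun k => by cases k <;> simp⟩

theorem sum_eq_red_add_blue {M : Type*} [AddCommMonoid M] (f : EdgeColor → M) :
    ∑ k, f k = f red + f blue :=
  Finset.sum_pair (by simp)

theorem prod_map_eq_pow_mul_pow {M : Type*} [CommMonoid M] (f : EdgeColor → M)
    (u : List EdgeColor) : (u.map f).prod = f red ^ u.count red * f blue ^ u.count blue := by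
  induction u with
  | nil => simp
  | cons k u ih => cases k <;> simp [ih, pow_succ'] <;> ac_rfl

/-- The fraction of the unprocessed vertices that a step of a given color keeps. The red fraction is
so small that `t` blue steps together lose at most half of the vertices. -/
noncomputable def threshold (t : ℕ) : EdgeColor → ℝ
  | red => 1 / (2 * t)
  | blue => 1 - 1 / (2 * t)

theorem sum_threshold (t : ℕ) : ∑ k, threshold t k = 1 := by
  simp [sum_eq_red_add_blue, threshold]

theorem threshold_red_le_half {t : ℕ} (ht : 0 < t) : threshold t red ≤ 1 / 2 := by
  have : (1 : ℝ) ≤ t := by exact_mod_cast ht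
  exact one_div_le_one_div_of_le two_pos (by linarith)

theorem threshold_pos {t : ℕ} (ht : 0 < t) (k : EdgeColor) : 0 < threshold t k := by
  cases k with
  | red => simp only [threshold]; positivity
  | blue =>
    have := threshold_red_le_half ht
    simp only [threshold] at this ⊢
    linarith

theorem half_le_threshold_blue_pow {t : ℕ} (ht : 0 < t) : 1 / 2 ≤ threshold t blue ^ t := by
  have hbern := one_add_mul_le_pow (a := -threshold t red)
    (by linarith [threshold_red_le_half ht]) t
  have hhalf : (t : ℝ) * threshold t red = 1 / 2 := by
    simp only [threshold]
    field_simp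
  calc (1 / 2 : ℝ) = 1 + t * -threshold t red := by linarith
    _ ≤ (1 + -threshold t red) ^ t := hbern
    _ = threshold t blue ^ t := by rw [← sub_eq_add_neg]; rfl

theorem le_prod_map_threshold {s t : ℕ} (ht : 0 < t) {u : List EdgeColor}
    (hred : u.count red ≤ s) (hblue : u.count blue ≤ t) :
    1 / (2 * (2 * (t : ℝ)) ^ s) ≤ (u.map (threshold t)).prod := by
  have hred_pos := threshold_pos ht red
  have hblue_pos := threshold_pos ht blue
  have hred_le : threshold t red ≤ 1 := by linarith [threshold_red_le_half ht]
  have hblue_le : threshold t blue ≤ 1 := by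
    linarith [sum_threshold t, sum_eq_red_add_blue (threshold t)]
  calc 1 / (2 * (2 * (t : ℝ)) ^ s) = threshold t red ^ s * (1 / 2) := by
        rw [threshold, one_div_pow, one_div_mul_one_div, mul_comm 2]
    _ ≤ threshold t red ^ s * threshold t blue ^ t := by
        gcongr
        exact half_le_threshold_blue_pow ht
    _ ≤ threshold t red ^ u.count red * threshold t blue ^ u.count blue :=
        mul_le_mul (pow_le_pow_of_le_one hred_pos.le hred_le hred)
          (pow_le_pow_of_le_one hblue_pos.le hblue_le hblue) (by positivity) (by positivity)
    _ = (u.map (threshold t)).prod := (prod_map_eq_pow_mul_pow _ _).symm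

end EdgeColor

section BoundedPaths

variable {V : Type*} [DecidableEq V] {col : Finset V → EdgeColor} {s t : ℕ}

/-- What the absence of a red `K_{s+3}^{3-}` and of a blue `K_t^3` says about colored paths. Three
vertices `z`, `v`, `x` must follow `s` red ones to form a red `K_{s+3}^{3-}`. -/
structure HasBoundedPaths (col : Finset V → EdgeColor) (s t : ℕ) : Prop where
  count_red_lt : ∀ ⦃l v x z⦄, AdmitsPair col (z :: l) v x →
    (l.map Prod.snd).count EdgeColor.red < s
  count_blue_lt : ∀ ⦃l v x⦄, AdmitsPair col l v x → (l.map Prod.snd).count EdgeColor.blue < t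

theorem HasBoundedPaths.count_red_le (hcol : HasBoundedPaths col s t)
    {l : List (V × EdgeColor)} {v x : V} (h : AdmitsPair col l v x) :
    (l.map Prod.snd).count EdgeColor.red ≤ s := by
  cases l with
  | nil => simp
  | cons z l =>
    have := hcol.count_red_lt h
    rw [List.map_cons, List.count_cons]
    split <;> omega

namespace SearchTree

theorem IsCompatible.child_eq_leaf (hcol : HasBoundedPaths col s t) {S : Finset V}
    (hS : S.Nonempty) {l : List (V × EdgeColor)} {w : V}
    {child : EdgeColor → SearchTree V EdgeColor} (h : (node w child).IsCompatible col S l)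
    (hl : s ≤ (l.map Prod.snd).count EdgeColor.red) (k : EdgeColor) : child k = leaf := by
  obtain ⟨x, hx⟩ := hS
  have hk := h.2 k
  cases hchild : child k with
  | leaf => rfl
  | node u grandchild =>
    rw [hchild] at hk
    exact absurd (hcol.count_red_lt (hk.1 x hx)) hl.not_gt

theorem IsCompatible.size_add_one_le (hcol : HasBoundedPaths col s t) {S : Finset V}
    (hS : S.Nonempty) {T : SearchTree V EdgeColor} {l : List (V × EdgeColor)}
    (h : T.IsCompatible col S l) {a b : ℕ}
    (ha : a = s - (l.map Prod.snd).count EdgeColor.red)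
    (hb : b = t - (l.map Prod.snd).count EdgeColor.blue) :
    T.size + 1 ≤ 2 * (a + b).choose a := by
  induction T generalizing l a b with
  | leaf =>
    have := Nat.choose_pos (Nat.le_add_right a b)
    simp only [size]
    omega
  | node w child ih =>
    obtain ⟨x, hx⟩ := hS
    have hblue := hcol.count_blue_lt (h.1 x hx)
    obtain ⟨b, rfl⟩ : ∃ b', b = b' + 1 := ⟨b - 1, by omega⟩
    rw [size, EdgeColor.sum_eq_red_add_blue]
    cases a with
    | zero =>
      have hleaf := h.child_eq_leaf hcol ⟨x, hx⟩ (by omega)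
      simp [hleaf, size]
    | succ a =>
      have hR := ih .red (h.2 .red) (a := a) (b := b + 1) (by simp; omega) (by simp; omega)
      have hL := ih .blue (h.2 .blue) (a := a + 1) (b := b) (by simp; omega) (by simp; omega)
      have pascal : (a + 1 + (b + 1)).choose (a + 1) =
          (a + (b + 1)).choose a + (a + 1 + b).choose (a + 1) := by
        rw [show a + 1 + (b + 1) = a + (b + 1) + 1 by ring, Nat.choose_succ_succ,
          show a + (b + 1) = a + 1 + b by ring]
      omega

theorem IsCompatible.exists_grow (hcol : HasBoundedPaths col s t) (ht : 0 < t) {A : Finset V}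
    (hA : 2 ≤ A.card) {T : SearchTree V EdgeColor} (hT : T.IsCompatible col A []) :
    ∃ (T' : SearchTree V EdgeColor) (A' : Finset V), T'.IsCompatible col A' [] ∧
      T'.size = T.size + 1 ∧ A.card ≤ 4 * (2 * t) ^ s * A'.card := by
  obtain ⟨v, hv⟩ : A.Nonempty := Finset.card_pos.1 (by omega)
  have hpair : ∀ x ∈ A.erase v, AdmitsPair col [] v x := fun x hx i j => by
    simpa [IsColoredPath] using Finset.ne_of_mem_erase hx
  obtain ⟨T', m, A', -, hT', hsize, hm, hcard⟩ := hT.exists_insert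
    (fun k => (EdgeColor.threshold_pos ht k).le) (EdgeColor.sum_threshold t) hv
    (A.erase_subset v) hpair
  have herase : A.card ≤ 2 * (A.erase v).card := by
    rw [Finset.card_erase_of_mem hv]
    omega
  have hprod : 0 < ((m.map Prod.snd).map (EdgeColor.threshold t)).prod :=
    List.prod_pos (by simp only [List.mem_map]; grind [EdgeColor.threshold_pos])
  obtain ⟨x, hx⟩ : A'.Nonempty := by
    have : (0 : ℝ) < (A.erase v).card := by exact_mod_cast (by omega : 0 < (A.erase v).card)
    exact Finset.card_pos.1 (by exact_mod_cast (mul_pos this hprod).trans_le hcard)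
  have hmx : AdmitsPair col m v x := by simpa using hm x hx
  have hloss := EdgeColor.le_prod_map_threshold ht (hcol.count_red_le hmx)
    (hcol.count_blue_lt hmx).le
  have hkept : ((A.erase v).card : ℝ) ≤ 2 * (2 * t) ^ s * A'.card := by
    rw [mul_comm, ← div_le_iff₀ (by positivity), div_eq_mul_one_div]
    exact (mul_le_mul_of_nonneg_left hloss (Nat.cast_nonneg _)).trans hcard
  have hkept' : (A.erase v).card ≤ 2 * (2 * t) ^ s * A'.card := by exact_mod_cast hkept
  exact ⟨T', A', hT', hsize, by linarith⟩

theorem exists_isCompatible_of_pow_le_card (hcol : HasBoundedPaths col s t) (ht : 0 < t)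
    {S : Finset V} (m n : ℕ) (hS : (4 * (2 * t) ^ s) ^ (m + n) ≤ S.card) :
    ∃ (T : SearchTree V EdgeColor) (A : Finset V), T.IsCompatible col A [] ∧ T.size = n ∧
      (4 * (2 * t) ^ s) ^ m ≤ A.card := by
  induction n generalizing m with
  | zero => exact ⟨leaf, S, trivial, rfl, hS⟩
  | succ n ih =>
    obtain ⟨T, A, hT, hn, hA⟩ := ih (m + 1) (by rwa [add_right_comm, add_assoc])
    have hbase : 0 < (2 * t) ^ s := by positivity
    have hA₂ : 2 ≤ A.card := by
      have := (Nat.le_self_pow (Nat.succ_ne_zero m) (4 * (2 * t) ^ s)).trans hA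
      omega
    obtain ⟨T', A', hT', hsize, hcard⟩ := hT.exists_grow hcol ht hA₂
    rw [pow_succ'] at hA
    exact ⟨T', A', hT', by omega, Nat.le_of_mul_le_mul_left (hA.trans hcard) (by positivity)⟩

end SearchTree

theorem HasBoundedPaths.card_lt [Fintype V] (hcol : HasBoundedPaths col s t) (ht : 0 < t) :
    Fintype.card V < (4 * (2 * t) ^ s) ^ (2 * (s + t).choose s) := by
  by_contra! hV
  obtain ⟨T, A, hT, hsize, hA⟩ := SearchTree.exists_isCompatible_of_pow_le_card hcol ht
    (S := Finset.univ) 0 (2 * (s + t).choose s) (by rwa [zero_add])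
  have hne : A.Nonempty := Finset.card_pos.1 (by simpa using hA)
  have := hT.size_add_one_le hcol hne (a := s) (b := t) (by simp) (by simp)
  omega

end BoundedPaths

section MonochromaticCopies

theorem exists_embedding_map_eq {α β : Type*} [Fintype α] {A : Finset α} {B W : Finset β}
    (hBW : B ⊆ W) (hAB : A.card = B.card) (hW : Fintype.card α ≤ W.card) :
    ∃ f : α ↪ β, A.map f = B ∧ ∀ a, f a ∈ W := by
  classical
  obtain ⟨U, hBU, hUW, hU⟩ :=
    Finset.exists_subsuperset_card_eq hBW (hAB ▸ A.card_le_univ) hW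
  let σ : α ≃ U := Fintype.equivOfCardEq (by simp [hU])
  let g : A ≃ B := Finset.equivOfCardEq hAB
  let f₀ : α → β := Function.extend Subtype.val (fun a : A => (g a : β)) fun a => σ a
  have hf₀ (a : A) : f₀ a = g a := Subtype.val_injective.extend_apply _ _ a
  have himage : A.image f₀ ⊆ U := by
    refine Finset.image_subset_iff.2 fun a ha => hBU ?_
    rw [hf₀ ⟨a, ha⟩]
    exact (g ⟨a, ha⟩).2
  have hinj : Set.InjOn f₀ A := fun a ha b hb hab => by
    rw [hf₀ ⟨a, ha⟩, hf₀ ⟨b, hb⟩] at hab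
    simpa using g.injective (Subtype.ext hab)
  obtain ⟨f, hf⟩ := Finset.exists_equiv_extend_of_card_eq hU.symm himage hinj
  refine ⟨f.toEmbedding.trans (.subtype (· ∈ U)), ?_, fun a => hUW (f a).2⟩
  refine Finset.eq_of_subset_of_card_le (fun b hb => ?_) (by rw [Finset.card_map, hAB])
  obtain ⟨a, ha, rfl⟩ := Finset.mem_map.1 hb
  have hfg : (f a : β) = g ⟨a, ha⟩ := (hf a ha).trans (hf₀ ⟨a, ha⟩)
  exact Set.mem_of_eq_of_mem hfg (g ⟨a, ha⟩).2

theorem length_filter_snd_eq {α κ : Type*} [DecidableEq κ] (l : List (α × κ)) (k : κ) :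
    (l.filter (·.2 = k)).length = (l.map Prod.snd).count k := by
  rw [List.count, List.countP_map, List.countP_eq_length_filter]
  congr 2

theorem eq_or_mem_of_triple_sublist {α : Type*} {p q r x y z : α} {l : List α}
    (h : [p, q, r].Sublist (x :: y :: z :: l)) : [p, q, r] = [x, y, z] ∨ r ∈ l := by
  grind

variable {n : ℕ} {col : Finset (Fin n) → EdgeColor}

theorem IsColoredPath.hasMonoCopy_complete {l : List (Fin n × EdgeColor)}
    (h : IsColoredPath col l) {k : EdgeColor} {t : ℕ} (ht : t ≤ (l.map Prod.snd).count k) :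
    HasMonoCopy (fun e => col e.1) k (complete 3 t) := by
  set m := l.filter (·.2 = k)
  have hm : IsColoredPath col m := h.sublist List.filter_sublist
  have hcard : t ≤ (m.map Prod.fst).toFinset.card := by
    rwa [List.toFinset_card_of_nodup hm.nodup, List.length_map, length_filter_snd_eq]
  obtain ⟨f⟩ : Nonempty (Fin t ↪ (m.map Prod.fst).toFinset) :=
    Function.Embedding.nonempty_of_card_le (by rwa [Fintype.card_fin, Fintype.card_coe])
  refine ⟨f.trans (.subtype _), fun e he => ?_⟩
  obtain ⟨p, q, r, hpqr, -, hcolor⟩ := hm.exists_triple_sublist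
    ((Finset.card_map (f.trans (.subtype _))).trans he)
    (by rw [← Finset.map_map]; exact Finset.map_subtype_subset _)
  have hr : r ∈ m := hpqr.subset (by simp)
  exact hcolor.trans (by simpa using (List.mem_filter.1 hr).2)

theorem IsColoredPath.hasMonoCopy_deleteEdge {x y z : Fin n × EdgeColor}
    {l : List (Fin n × EdgeColor)} (h : IsColoredPath col (x :: y :: z :: l)) {k : EdgeColor}
    {s : ℕ} (hs : s ≤ (l.map Prod.snd).count k) {e₀ : Finset (Fin (s + 3))} (he₀ : e₀.card = 3) :
    HasMonoCopy (fun e => col e.1) k ((complete 3 (s + 3)).deleteEdge e₀) := by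
  set m := l.filter (·.2 = k)
  have hm : IsColoredPath col (x :: y :: z :: m) :=
    h.sublist (((List.filter_sublist.cons_cons z).cons_cons y).cons_cons x)
  set U : Finset (Fin n) := ([x, y, z].map Prod.fst).toFinset
  set W : Finset (Fin n) := ((x :: y :: z :: m).map Prod.fst).toFinset
  have hUW : U ⊆ W := by
    intro v
    simp only [U, W, List.mem_toFinset, List.map_cons, List.map_nil, List.mem_cons]
    tauto
  have hU : U.card = 3 :=
    List.toFinset_card_of_nodup (h.sublist (m := [x, y, z]) (by simp)).nodup
  have hW : s + 3 ≤ W.card := by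
    rw [List.toFinset_card_of_nodup hm.nodup, List.length_map]
    simpa [m, length_filter_snd_eq] using hs
  obtain ⟨f, hf₀, hf⟩ := exists_embedding_map_eq hUW (he₀.trans hU.symm) (by simpa using hW)
  refine ⟨f, fun e he => ?_⟩
  obtain ⟨p, q, r, hpqr, hmap, hcolor⟩ := hm.exists_triple_sublist
    ((Finset.card_map f).trans he.1)
    (Finset.map_subset_iff_subset_preimage.2 fun a _ => Finset.mem_preimage.2 (hf a))
  obtain hxyz | hr := eq_or_mem_of_triple_sublist hpqr
  · have hU_eq : e.map f = U := by simp [U, ← hxyz, hmap]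
    exact absurd (Finset.map_injective f (hU_eq.trans hf₀.symm)) he.2
  · exact hcolor.trans (by simpa using (List.mem_filter.1 hr).2)

end MonochromaticCopies

theorem arrows_deleteEdge_complete {s t : ℕ} (ht : 0 < t) {e₀ : Finset (Fin (s + 3))}
    (he₀ : e₀.card = 3) :
    Arrows ((4 * (2 * t) ^ s) ^ (2 * (s + t).choose s)) ((complete 3 (s + 3)).deleteEdge e₀)
      (complete 3 t) := by
  intro c
  obtain ⟨col, rfl⟩ : ∃ col : Finset (Fin _) → EdgeColor, c = fun e => col e.1 :=
    ⟨Function.extend Subtype.val c fun _ => .red,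
      funext fun e => (Subtype.val_injective.extend_apply c _ e).symm⟩
  by_contra! hcon
  have hcol : HasBoundedPaths col s t := by
    constructor
    · intro l v x z h
      by_contra! hs
      exact hcon.1 ((h .red .red).hasMonoCopy_deleteEdge hs he₀)
    · intro l v x h
      by_contra! hb
      exact hcon.2 ((h .red .red).2.2.2.2.hasMonoCopy_complete hb)
  simpa using hcol.card_lt ht

section Containment

variable {k : ℕ} {V V' W : Type}

theorem IsContainedIn.refl (F : UniformHypergraph k V) : F.IsContainedIn F :=
  ⟨.refl V, fun e he => by rwa [Finset.map_refl]⟩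

theorem HasMonoCopy.of_isContainedIn {n : ℕ} {c : Coloring k n} {x : EdgeColor}
    {F : UniformHypergraph k V} {G : UniformHypergraph k W} (h : HasMonoCopy c x G)
    (hFG : F.IsContainedIn G) : HasMonoCopy c x F := by
  obtain ⟨f, hf⟩ := h
  obtain ⟨g, hg⟩ := hFG
  exact ⟨g.trans f, fun e he => by simpa only [Finset.map_map] using hf _ (hg e he)⟩

theorem Arrows.of_isContainedIn {n : ℕ} {F : UniformHypergraph k V} {F' : UniformHypergraph k V'}
    {G : UniformHypergraph k W} (h : Arrows n F G) (hF : F'.IsContainedIn F) : Arrows n F' G :=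
  fun c => (h c).imp_left fun hc => hc.of_isContainedIn hF

theorem Arrows.isLeast_ramseyNumber {n : ℕ} {F : UniformHypergraph k V}
    {G : UniformHypergraph k W} (h : Arrows n F G) :
    IsLeast {n : ℕ | Arrows n F G} (ramseyNumber F G) :=
  ⟨Nat.sInf_mem ⟨n, h⟩, fun _ hm => Nat.sInf_le hm⟩

theorem isContainedIn_tightCycle_K5minus : IsContainedIn (tightCycle 3 5) K5minus := by
  -- The missing edge is the image of `{0, 1, 3}`, which is not an interval of `ℤ/5`.
  let f : Fin 5 → Fin 5 := ![2, 3, 0, 4, 1]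
  have hf : Function.Injective f := by decide
  refine ⟨⟨f, hf⟩, ?_⟩
  rintro e ⟨he, i, rfl⟩
  refine ⟨(Finset.card_map _).trans he, ?_⟩
  clear he
  revert i
  decide +revert

end Containment

theorem pow_two_mul_choose_lt {s t : ℕ} (ht : 2 ≤ t) :
    (4 * (2 * t) ^ s) ^ (2 * (s + t).choose s) < t ^ ((4 * (s + 1) ^ (s + 1) + 1) * t ^ s) := by
  have hbase : 4 * (2 * t) ^ s ≤ t ^ (2 * (s + 1)) :=
    calc 4 * (2 * t) ^ s = 2 ^ 2 * (2 * t) ^ s := by norm_num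
      _ ≤ t ^ 2 * (t * t) ^ s := by gcongr
      _ = t ^ (2 * (s + 1)) := by ring
  have hchoose : (s + t).choose s ≤ (s + 1) ^ s * t ^ s :=
    calc (s + t).choose s ≤ (s + t) ^ s := Nat.choose_le_pow _ _
      _ ≤ ((s + 1) * t) ^ s := by gcongr; nlinarith
      _ = (s + 1) ^ s * t ^ s := mul_pow _ _ _
  have hexp : 2 * (s + 1) * (2 * (s + t).choose s) < (4 * (s + 1) ^ (s + 1) + 1) * t ^ s :=
    calc 2 * (s + 1) * (2 * (s + t).choose s)
        ≤ 2 * (s + 1) * (2 * ((s + 1) ^ s * t ^ s)) := by gcongr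
      _ < 2 * (s + 1) * (2 * ((s + 1) ^ s * t ^ s)) + t ^ s := by
          have : 0 < t ^ s := by positivity
          omega
      _ = (4 * (s + 1) ^ (s + 1) + 1) * t ^ s := by ring
  calc (4 * (2 * t) ^ s) ^ (2 * (s + t).choose s)
      ≤ (t ^ (2 * (s + 1))) ^ (2 * (s + t).choose s) := by gcongr
    _ = t ^ (2 * (s + 1) * (2 * (s + t).choose s)) := (pow_mul _ _ _).symm
    _ < t ^ ((4 * (s + 1) ^ (s + 1) + 1) * t ^ s) := Nat.pow_lt_pow_right (by omega) hexp

theorem natCast_pow_mul_eq_two_rpow {t : ℕ} (ht : 0 < t) (c m : ℕ) :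
    (t : ℝ) ^ (c * m) = 2 ^ (c / Real.log 2 * m * Real.log t) := by
  have ht' : (0 : ℝ) < t := by exact_mod_cast ht
  have hlog2 : Real.log 2 ≠ 0 := (Real.log_pos one_lt_two).ne'
  rw [← Real.rpow_natCast, Real.rpow_def_of_pos ht', Real.rpow_def_of_pos two_pos]
  congr 1
  push_cast
  field_simp

end UniformHypergraph

open UniformHypergraph in
theorem mainTheorem2_general (s : ℕ) :
    ∃ C : ℝ, 0 < C ∧ ∀ t : ℕ, 2 ≤ t →
      ∀ {V : Type} (F : UniformHypergraph 3 V) (e₀ : Finset (Fin (s + 3))), e₀.card = 3 →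
        F.IsContainedIn ((complete 3 (s + 3)).deleteEdge e₀) →
        IsLeast {n : ℕ | Arrows n F (complete 3 t)} (ramseyNumber F (complete 3 t)) ∧
        (ramseyNumber F (complete 3 t) : ℝ) < (2 : ℝ) ^ (C * (t : ℝ) ^ s * Real.log (t : ℝ)) := by
  set c : ℕ := 4 * (s + 1) ^ (s + 1) + 1
  refine ⟨c / Real.log 2, div_pos (by positivity) (Real.log_pos one_lt_two),
    fun t ht V F e₀ he₀ hF => ?_⟩
  have harrows := (arrows_deleteEdge_complete (by omega : 0 < t) he₀).of_isContainedIn hF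
  have hleast := harrows.isLeast_ramseyNumber
  refine ⟨hleast, ?_⟩
  rw [← Nat.cast_pow, ← natCast_pow_mul_eq_two_rpow (by omega)]
  exact_mod_cast (hleast.2 harrows).trans_lt (pow_two_mul_choose_lt ht)

theorem mainTheorem2 :
    (∃ C : ℝ, 0 < C ∧ ∀ t : ℕ, 2 ≤ t →
      -- the minimum defining `r(K_5^{3-}, K_t^3)` exists
      IsLeast {n : ℕ | UniformHypergraph.Arrows n UniformHypergraph.K5minus
          (UniformHypergraph.complete 3 t)}
        (UniformHypergraph.ramseyNumber UniformHypergraph.K5minus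
          (UniformHypergraph.complete 3 t)) ∧
      (UniformHypergraph.ramseyNumber UniformHypergraph.K5minus
          (UniformHypergraph.complete 3 t) : ℝ)
        ≤ (2 : ℝ) ^ (C * (t : ℝ) ^ 2 * Real.log (t : ℝ))) ∧
    UniformHypergraph.IsContainedIn (UniformHypergraph.tightCycle 3 5)
      UniformHypergraph.K5minus ∧
    (∃ b : ℝ, 0 < b ∧ ∀ t : ℕ, 2 ≤ t →
      -- the minimum defining `r(C_5^3, K_t^3)` exists
      IsLeast {n : ℕ | UniformHypergraph.Arrows n (UniformHypergraph.tightCycle 3 5)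
          (UniformHypergraph.complete 3 t)}
        (UniformHypergraph.ramseyNumber (UniformHypergraph.tightCycle 3 5)
          (UniformHypergraph.complete 3 t)) ∧
      (UniformHypergraph.ramseyNumber (UniformHypergraph.tightCycle 3 5)
          (UniformHypergraph.complete 3 t) : ℝ)
        < (2 : ℝ) ^ (b * (t : ℝ) ^ 2 * Real.log (t : ℝ))) := by
  obtain ⟨C, hC, h⟩ := mainTheorem2_general 2
  have hK5 (t : ℕ) (ht : 2 ≤ t) :=
    h t ht UniformHypergraph.K5minus {2, 3, 4} rfl (UniformHypergraph.IsContainedIn.refl _)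
  exact ⟨⟨C, hC, fun t ht => (hK5 t ht).imp_right le_of_lt⟩,
    UniformHypergraph.isContainedIn_tightCycle_K5minus,
    C, hC, fun t ht => h t ht _ _ rfl UniformHypergraph.isContainedIn_tightCycle_K5minus⟩
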